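/- Let $\xi_1,\xi_2,\dots$ be independent $N(0,1)$ random variables, let $\sigma>0$ be known, let $\mu=(\mu_1,\mu_2,\dots)\in\ell_2$, and observe $Y_i=\mu_i+\sigma\xi_i$, $i=1,2,\dots$. Let $\mathcal M$ be a non-empty finite set of positive integers. For $m\in\mathcal M$ let $\hat\mu^m(Y)$ be the projection estimator $\hat\mu^m_i(Y)=\mathbf 1\{i\le m\}Y_i$, let $$\bar r(Y,\hat\mu^m)=-\sum_{i=1}^m Y_i^2+2\sigma^2m$$ be its unbiased risk estimate (up to an additive constant), and put $$w^*_m(Y)=\frac{\exp\{-\bar r(Y,\hat\mu^m)/(4\sigma^2)\}}{\sum_{s\in\mathcal M}\exp\{-\bar r(Y,\hat\mu^s)/(4\sigma^2)\}},\qquad \bar\mu^{w^*}(Y)=\sum_{m\in\mathcal M}w^*_m(Y)\hat\mu^m(Y).$$ Let $$r^{\mathcal M}(\mu)=\min_{m\in\mathcal M}\Bigl\{\sum_{i=m+1}^\infty\mu_i^2+\sigma^2m\Bigr\}$$ be the oracle risk; since $m\ge1$ for all $m\in\mathcal M$, one has $\sigma^2/r^{\mathcal M}(\mu)\in(0,1]$.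 **Theorem.** There is a bounded function $\Psi:[0,1]\to[0,\infty)$ with $\lim_{r\to0+}\Psi(r)=0$, which does not depend on $\mu$, $\sigma$ or $\mathcal M$, such that for all $\mu\in\ell_2$, $\sigma>0$ and all non-empty finite sets $\mathcal M$ of positive integers $$\mathbf E\,\|\bar\mu^{w^*}(Y)-\mu\|^2\le r^{\mathcal M}(\mu)+4\sigma^2\log\Bigl\{\frac{r^{\mathcal M}(\mu)}{\sigma^2}\Bigl[1+\Psi\Bigl(\frac{\sigma^2}{r^{\mathcal M}(\mu)}\Bigr)\Bigr]\Bigr\},$$ where $\|\cdot\|$ is the norm of $\ell_2$. -/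

import Mathlib

/-!
Sequences indexed by `1, 2, …` in the text are functions on `ℕ` here, the coordinate of number
`i + 1` being the value at `i`. Hence the first `m` coordinates are those with index `i < m`, and
`∑_{i > m}` in the numbering from one is the sum over all indices `≥ m`.
-/

namespace ExpWeighting

open MeasureTheory

noncomputable section

/-- The observation `Y_i = μ_i + σ ξ_i`. -/
def obs (σ : ℝ) (μ x : ℕ → ℝ) : ℕ → ℝ := fun i => μ i + σ * x i

/-- The projection estimator: keep the first `m` coordinates of `y`, put zero elsewhere. -/
def projEst (m : ℕ) (y : ℕ → ℝ) : ℕ → ℝ := fun i => if i < m then y i else 0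

/-- The unbiased risk estimate (up to an additive constant) of the projection estimator:
`- ∑_{i = 1}^m y_i² + 2 σ² m`. -/
def riskEst (σ : ℝ) (m : ℕ) (y : ℕ → ℝ) : ℝ :=
  -(∑ i ∈ Finset.range m, y i ^ 2) + 2 * σ ^ 2 * (m : ℝ)

/-- The exponential weight of the model `m` in the family `M`. -/
def expWeight (σ : ℝ) (M : Finset ℕ) (y : ℕ → ℝ) (m : ℕ) : ℝ :=
  Real.exp (-(riskEst σ m y / (4 * σ ^ 2))) /
    ∑ s ∈ M, Real.exp (-(riskEst σ s y / (4 * σ ^ 2)))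

/-- The combination `∑_{m ∈ M} w_m(y) μ̂^m(y)` of the projection estimators with weights `w`. -/
def combEst (M : Finset ℕ) (w : (ℕ → ℝ) → ℕ → ℝ) (y : ℕ → ℝ) : ℕ → ℝ :=
  fun i => ∑ m ∈ M, w y m * projEst m y i

/-- The mean square risk `E ‖est(Y) - μ‖²` of an estimator `est` when `Y = μ + σ ξ` is observed,
as an extended non-negative number. -/
def risk {Ω : Type*} [MeasurableSpace Ω] (P : Measure Ω) (ξ : ℕ → Ω → ℝ) (σ : ℝ) (μ : ℕ → ℝ)
    (est : (ℕ → ℝ) → ℕ → ℝ) : ENNReal :=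
  ∫⁻ ω, ∑' i, ENNReal.ofReal ((est (obs σ μ (fun j => ξ j ω)) i - μ i) ^ 2) ∂P

/-- The oracle risk `min_{m ∈ M} { ∑_{i > m} μ_i² + σ² m }`. -/
def oracleRisk (σ : ℝ) (M : Finset ℕ) (hM : M.Nonempty) (μ : ℕ → ℝ) : ℝ :=
  M.inf' hM (fun m => (∑' i, μ (m + i) ^ 2) + σ ^ 2 * (m : ℝ))

end

end ExpWeighting

/-!
Write `R` for the oracle risk in units of `σ ^ 2`, `m₀` for the model attaining it, and
`d m = (riskEst m - riskEst m₀) / (4 σ ^ 2)`, so that the weights `w m` are proportional to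
`exp (-d m)`.

*The risk is a mean of risk estimates.* The `i`-th coordinate of the estimator is `h Y_i`, where
`h` is the total weight of the models keeping that coordinate. As a function of `y = Y_i` alone,
`h = A e / (A e + B)` with `e = exp (y ^ 2 / (4 σ ^ 2))` and with `A`, `B` independent of the noise
in that coordinate. Since `h' = h (1 - h) y / (2 σ ^ 2)`, Stein's identity gives the exact formula
`E (h Y_i - μ_i) ^ 2 = E [Y_i ^ 2 - σ ^ 2 + h (2 σ ^ 2 - Y_i ^ 2)]` (`integral_steinGap`): the
temperature `4 σ ^ 2` is the one for which the terms quadratic in `h` cancel. Summing over `i`, the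
risk is `‖μ‖ ^ 2 + E ∑ w m * riskEst m` (`risk_eq`), which is the oracle risk plus
`4 σ ^ 2 * E ∑ w m * d m`.

*The excess is an entropy.* The normalising constant of `exp (-d m)` is at least `1`, hence
`d m ≤ - log (w m)`, and over at most `L` models the mean of the latter is at most `log L`. The
models outside this set contribute at most a multiple of `∑ exp (-θ d m)` (`sum_gibbs_mul_le`).

*Only about `R` models matter.* For `m > m₀` the difference `riskEst m - riskEst m₀` is a random
walk in `m` whose drift over `n` steps is, in units of `σ ^ 2`, at least `n` minus the bias of `m₀`.
The exponential moments of squared normal variables at a small exponent `θ / 4` show that models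
with `m > L = (R + K) / (1 - 2 θ)` contribute `O(θ⁻² exp (-θ K / 4))`
(`integral_sum_expWeight_mul_riskDiff_le`). There are at most `L` other models, and with
`θ = R ^ (-1/4) / 4`, `K = R ^ (3/4)` both `L / R - 1` and the contribution of the large models are
bounded and tend to `0` as `R → ∞`, which is what `remainder` records.
-/

open MeasureTheory ProbabilityTheory

namespace ExpWeighting

/-! ### Stein's identity and the risk of one coordinate -/

lemma integrable_gaussianReal_iff {f : ℝ → ℝ} :
    Integrable f (gaussianReal 0 1) ↔ Integrable (fun x => gaussianPDFReal 0 1 x * f x) := by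
  rw [gaussianReal_of_var_ne_zero _ one_ne_zero,
    integrable_withDensity_iff_integrable_smul' (measurable_gaussianPDF 0 1)
      (Filter.Eventually.of_forall fun x => gaussianPDF_lt_top)]
  simp [toReal_gaussianPDF]

lemma hasDerivAt_gaussianPDFReal (x : ℝ) :
    HasDerivAt (gaussianPDFReal 0 1) (-(x * gaussianPDFReal 0 1 x)) x := by
  have h : HasDerivAt (fun x : ℝ => -(x - 0) ^ 2 / (2 * ((1 : NNReal) : ℝ))) (-x) x := by
    have := ((((hasDerivAt_id x).sub_const 0).pow 2).neg).div_const (2 * ((1 : NNReal) : ℝ))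
    convert! this using 1
    simp only [id, NNReal.coe_one]
    ring
  have h2 := (h.exp).const_mul ((√(2 * Real.pi * ((1 : NNReal) : ℝ)))⁻¹)
  rw [gaussianPDFReal_def]
  convert! h2 using 1
  ring

/-- Stein's identity `E ξ g(ξ) = E g'(ξ)` for a standard normal variable `ξ`. -/
lemma integral_mul_sub_deriv_gaussianReal {g g' : ℝ → ℝ} (hg : ∀ x, HasDerivAt g (g' x) x)
    (hgi : Integrable g (gaussianReal 0 1))
    (hi : Integrable (fun x => x * g x - g' x) (gaussianReal 0 1)) :
    ∫ x, (x * g x - g' x) ∂(gaussianReal 0 1) = 0 := by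
  rw [integral_gaussianReal_eq_integral_smul one_ne_zero]
  have hd : ∀ x, HasDerivAt (fun x => -(gaussianPDFReal 0 1 x * g x))
      (gaussianPDFReal 0 1 x • (x * g x - g' x)) x := by
    intro x
    convert! ((hasDerivAt_gaussianPDFReal x).mul (hg x)).neg using 1
    simp only [smul_eq_mul]; ring
  exact integral_eq_zero_of_hasDerivAt_of_integrable hd (integrable_gaussianReal_iff.1 hi)
    (integrable_gaussianReal_iff.1 hgi).neg

lemma integrable_sq_gaussianReal : Integrable (fun x : ℝ => x ^ 2) (gaussianReal 0 1) :=
  (memLp_id_gaussianReal 2).integrable_sq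

/-- The factor by which a coordinate `y` of the observation is multiplied when the models keeping
it have total weight proportional to `A * exp (y ^ 2 / (4 * σ ^ 2))` and the models dropping it
have total weight proportional to `B`. -/
noncomputable def shrink (σ A B y : ℝ) : ℝ :=
  A * Real.exp (y ^ 2 / (4 * σ ^ 2)) / (A * Real.exp (y ^ 2 / (4 * σ ^ 2)) + B)

section shrink

variable {σ A B : ℝ}

lemma shrink_nonneg (hA : 0 < A) (hB : 0 ≤ B) (y : ℝ) : 0 ≤ shrink σ A B y := by
  unfold shrink; positivity

lemma shrink_le_one (hA : 0 < A) (hB : 0 ≤ B) (y : ℝ) : shrink σ A B y ≤ 1 := by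
  unfold shrink
  rw [div_le_one (by positivity)]
  linarith

lemma hasDerivAt_shrink (hσ : 0 < σ) (hA : 0 < A) (hB : 0 ≤ B) (y : ℝ) :
    HasDerivAt (shrink σ A B)
      (shrink σ A B y * (1 - shrink σ A B y) * (y / (2 * σ ^ 2))) y := by
  have h1 : HasDerivAt (fun y : ℝ => A * Real.exp (y ^ 2 / (4 * σ ^ 2)))
      (A * (Real.exp (y ^ 2 / (4 * σ ^ 2)) * (y / (2 * σ ^ 2)))) y := by
    refine (HasDerivAt.exp ?_).const_mul A
    convert! (hasDerivAt_pow 2 y).div_const (4 * σ ^ 2) using 1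
    field_simp
    norm_num
    ring
  have hpos : 0 < A * Real.exp (y ^ 2 / (4 * σ ^ 2)) + B := by positivity
  have h2 := h1.div (h1.add_const B) hpos.ne'
  convert! h2 using 1
  unfold shrink
  generalize Real.exp (y ^ 2 / (4 * σ ^ 2)) = e at *
  field_simp

/-- The squared error of the shrunken coordinate at `y = μ + σ x` minus its unbiased estimate. -/
noncomputable def steinGap (σ μ A B x : ℝ) : ℝ :=
  (shrink σ A B (μ + σ * x) * (μ + σ * x) - μ) ^ 2 -
    ((μ + σ * x) ^ 2 - σ ^ 2 + shrink σ A B (μ + σ * x) * (2 * σ ^ 2 - (μ + σ * x) ^ 2))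

lemma abs_steinGap_le (hA : 0 < A) (hB : 0 ≤ B) (μ x : ℝ) :
    |steinGap σ μ A B x| ≤ 4 * (μ + σ * x) ^ 2 + 2 * μ ^ 2 + 3 * σ ^ 2 := by
  unfold steinGap
  have h0 := shrink_nonneg (σ := σ) hA hB (μ + σ * x)
  have h1 := shrink_le_one (σ := σ) hA hB (μ + σ * x)
  generalize μ + σ * x = y at *
  generalize shrink σ A B y = h at *
  have hsq : h ^ 2 ≤ 1 := by nlinarith
  have e1 : (h * y - μ) ^ 2 ≤ 2 * y ^ 2 + 2 * μ ^ 2 := by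
    nlinarith [sq_nonneg (h * y + μ), mul_nonneg (sub_nonneg.2 hsq) (sq_nonneg y)]
  have e2 : h * y ^ 2 ≤ y ^ 2 := by nlinarith [mul_nonneg (sub_nonneg.2 h1) (sq_nonneg y)]
  have e3 : h * σ ^ 2 ≤ σ ^ 2 := by nlinarith [mul_nonneg (sub_nonneg.2 h1) (sq_nonneg σ)]
  have e4 : 0 ≤ h * y ^ 2 := by positivity
  have e5 : 0 ≤ h * σ ^ 2 := by positivity
  rw [abs_le]
  constructor <;> nlinarith [sq_nonneg (h * y - μ), sq_nonneg y, sq_nonneg σ, sq_nonneg μ]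

lemma integrable_quadratic_gaussianReal (a b c d : ℝ) :
    Integrable (fun x : ℝ => c * (a + b * x) ^ 2 + d) (gaussianReal 0 1) := by
  have h1 : Integrable (fun x : ℝ => x) (gaussianReal 0 1) :=
    (memLp_id_gaussianReal 1).integrable le_rfl
  have : (fun x : ℝ => c * (a + b * x) ^ 2 + d) =
      fun x => (c * a ^ 2 + d) + 2 * c * a * b * x + c * b ^ 2 * x ^ 2 := by
    ext x; ring
  rw [this]
  exact ((integrable_const _).add (h1.const_mul _)).add (integrable_sq_gaussianReal.const_mul _)

lemma measurable_shrink (σ : ℝ) :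
    Measurable (fun p : ℝ × ℝ × ℝ => shrink σ p.2.1 p.2.2 p.1) := by
  unfold shrink; fun_prop

lemma measurable_steinGap (σ μ : ℝ) :
    Measurable (fun p : ℝ × ℝ × ℝ => steinGap σ μ p.2.1 p.2.2 p.1) := by
  unfold steinGap shrink; fun_prop

/-- The unbiased estimate is exact: the shrinkage factor satisfies
`h' = h * (1 - h) * y / (2 * σ ^ 2)`, so Stein's identity turns the cross term of the squared
error into a multiple of `h * (1 - h) * y ^ 2`, which cancels the quadratic term in `h`. -/
lemma integral_steinGap (hσ : 0 < σ) (hA : 0 < A) (hB : 0 ≤ B) (μ : ℝ) :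
    ∫ x, steinGap σ μ A B x ∂(gaussianReal 0 1) = 0 := by
  set g : ℝ → ℝ := fun x =>
    2 * σ * (shrink σ A B (μ + σ * x) - 1) * (μ + σ * x) + σ ^ 2 * x with hgdef
  set g' : ℝ → ℝ := fun x => 2 * σ ^ 2 * (shrink σ A B (μ + σ * x) - 1) +
    shrink σ A B (μ + σ * x) * (1 - shrink σ A B (μ + σ * x)) * (μ + σ * x) ^ 2 + σ ^ 2
  have hg : ∀ x, HasDerivAt g (g' x) x := by
    intro x
    have hy : HasDerivAt (fun x : ℝ => μ + σ * x) σ x := by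
      simpa using ((hasDerivAt_id x).const_mul σ).const_add μ
    have hs := (hasDerivAt_shrink hσ hA hB (μ + σ * x)).comp x hy
    have := ((((hs.sub_const 1).const_mul (2 * σ)).mul hy)).add
      ((hasDerivAt_id x).const_mul (σ ^ 2))
    convert! this using 1
    simp only [g', Function.comp_apply]
    field_simp
    ring
  have hmeas : Measurable (fun x => shrink σ A B (μ + σ * x)) :=
    (measurable_shrink σ).comp (by fun_prop : Measurable fun x : ℝ => (μ + σ * x, A, B))
  have hgap : ∀ x, steinGap σ μ A B x = x * g x - g' x := by
    intro x
    simp only [steinGap, g, g']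
    ring
  have hint : Integrable (steinGap σ μ A B) (gaussianReal 0 1) := by
    refine (integrable_quadratic_gaussianReal μ σ 4 (2 * μ ^ 2 + 3 * σ ^ 2)).mono'
      ((measurable_steinGap σ μ).comp
        (by fun_prop : Measurable fun x : ℝ => (x, A, B))).aestronglyMeasurable ?_
    refine Filter.Eventually.of_forall fun x => ?_
    have := abs_steinGap_le (σ := σ) hA hB μ x
    rw [Real.norm_eq_abs]; linarith
  have hgi : Integrable g (gaussianReal 0 1) := by
    have h1 := (integrable_quadratic_gaussianReal μ σ 1 (σ ^ 2)).add
      (integrable_quadratic_gaussianReal 0 1 (σ ^ 2) (σ ^ 2))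
    refine h1.mono' (by rw [hgdef]; fun_prop) ?_
    refine Filter.Eventually.of_forall fun x => ?_
    have h0 := shrink_nonneg (σ := σ) hA hB (μ + σ * x)
    have h1 := shrink_le_one (σ := σ) hA hB (μ + σ * x)
    simp only [Pi.add_apply, g, Real.norm_eq_abs]
    generalize μ + σ * x = y at *
    generalize shrink σ A B y = h at *
    have hk : (1 - h) ^ 2 ≤ 1 := by nlinarith
    have hk2 : (σ * (1 - h)) ^ 2 ≤ σ ^ 2 := by
      rw [mul_pow]; nlinarith [sq_nonneg σ]
    rw [abs_le]
    constructor <;> nlinarith [sq_nonneg (σ * (1 - h) - y), sq_nonneg (σ * (1 - h) + y),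
      mul_nonneg (sq_nonneg σ) (sq_nonneg (x - 1)), mul_nonneg (sq_nonneg σ) (sq_nonneg (x + 1)),
      mul_nonneg (sq_nonneg σ) (sq_nonneg x)]
  have hfun : steinGap σ μ A B = fun x => x * g x - g' x := funext hgap
  rw [hfun] at hint ⊢
  exact integral_mul_sub_deriv_gaussianReal hg hgi hint

end shrink

section independent

variable {Ω : Type*} [MeasurableSpace Ω] {P : Measure Ω}

lemma integrable_comp_of_hasLaw {X : Ω → ℝ} {ν : Measure ℝ} (hX : HasLaw X ν P) {f : ℝ → ℝ}
    (hf : Integrable f ν) : Integrable (fun ω => f (X ω)) P := by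
  rw [← hX.map_eq] at hf
  exact hf.comp_aemeasurable hX.aemeasurable

variable {X A B : Ω → ℝ} {σ : ℝ}

lemma integrable_steinGap_comp (hX : HasLaw X (gaussianReal 0 1) P) (mX : Measurable X)
    (mA : Measurable A) (mB : Measurable B) (hA : ∀ ω, 0 < A ω) (hB : ∀ ω, 0 ≤ B ω) (μ : ℝ) :
    Integrable (fun ω => steinGap σ μ (A ω) (B ω) (X ω)) P := by
  refine (integrable_comp_of_hasLaw hX
    (integrable_quadratic_gaussianReal μ σ 4 (2 * μ ^ 2 + 3 * σ ^ 2))).mono'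
      ((measurable_steinGap σ μ).comp
        (by fun_prop : Measurable fun ω => (X ω, A ω, B ω))).aestronglyMeasurable ?_
  refine Filter.Eventually.of_forall fun ω => ?_
  have := abs_steinGap_le (σ := σ) (hA ω) (hB ω) μ (X ω)
  rw [Real.norm_eq_abs]; linarith

/-- The identity `integral_steinGap` for random `A` and `B` independent of the noise. -/
lemma integral_steinGap_comp [IsProbabilityMeasure P] (hσ : 0 < σ)
    (hX : HasLaw X (gaussianReal 0 1) P) (mX : Measurable X)
    (mA : Measurable A) (mB : Measurable B) (hA : ∀ ω, 0 < A ω) (hB : ∀ ω, 0 ≤ B ω)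
    (hind : IndepFun X (fun ω => (A ω, B ω)) P) (μ : ℝ) :
    ∫ ω, steinGap σ μ (A ω) (B ω) (X ω) ∂P = 0 := by
  have mAB : Measurable (fun ω => (A ω, B ω)) := mA.prodMk mB
  have hint := integrable_steinGap_comp (σ := σ) hX mX mA mB hA hB μ
  have hmap := (indepFun_iff_map_prod_eq_prod_map_map mX.aemeasurable mAB.aemeasurable).1 hind
  rw [hX.map_eq] at hmap
  have mpair : Measurable (fun ω => (X ω, A ω, B ω)) := mX.prodMk mAB
  have e1 : ∫ ω, steinGap σ μ (A ω) (B ω) (X ω) ∂P =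
      ∫ p, steinGap σ μ p.2.1 p.2.2 p.1 ∂(P.map fun ω => (X ω, A ω, B ω)) :=
    (integral_map mpair.aemeasurable (measurable_steinGap σ μ).aestronglyMeasurable).symm
  have hint' : Integrable (fun p : ℝ × ℝ × ℝ => steinGap σ μ p.2.1 p.2.2 p.1)
      (P.map fun ω => (X ω, A ω, B ω)) :=
    (integrable_map_measure (measurable_steinGap σ μ).aestronglyMeasurable
      mpair.aemeasurable).2 hint
  have : IsProbabilityMeasure (P.map fun ω => (A ω, B ω)) :=
    Measure.isProbabilityMeasure_map mAB.aemeasurable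
  rw [e1]
  rw [hmap] at hint' ⊢
  rw [integral_prod_symm _ hint']
  refine integral_eq_zero_of_ae ?_
  have hset : MeasurableSet {z : ℝ × ℝ | 0 < z.1 ∧ 0 ≤ z.2} :=
    (measurableSet_lt measurable_const measurable_fst).inter
      (measurableSet_le measurable_const measurable_snd)
  have hae : ∀ᵐ z ∂(P.map fun ω => (A ω, B ω)), 0 < z.1 ∧ 0 ≤ z.2 :=
    (ae_map_iff mAB.aemeasurable hset).2 (Filter.Eventually.of_forall fun ω => ⟨hA ω, hB ω⟩)
  filter_upwards [hae] with z hz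
  exact integral_steinGap hσ hz.1 hz.2 μ

end independent

/-! ### The risk as a mean of weighted risk estimates -/

section weights

variable {σ : ℝ} {M : Finset ℕ} {y : ℕ → ℝ}

lemma expWeight_nonneg (m : ℕ) : 0 ≤ expWeight σ M y m := by
  unfold expWeight; positivity

lemma sum_expWeight (hM : M.Nonempty) : ∑ m ∈ M, expWeight σ M y m = 1 := by
  unfold expWeight
  rw [← Finset.sum_div]
  exact div_self (Finset.sum_pos (fun _ _ => Real.exp_pos _) hM).ne'

lemma expWeight_le_one (hM : M.Nonempty) {m : ℕ} (hm : m ∈ M) : expWeight σ M y m ≤ 1 := by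
  rw [← sum_expWeight (σ := σ) (y := y) hM]
  exact Finset.single_le_sum (f := expWeight σ M y) (fun _ _ => expWeight_nonneg _) hm

/-- The unnormalised exponential weight of the model `m`, with the coordinate `i` left out. -/
noncomputable def partialWeight (σ : ℝ) (μ : ℕ → ℝ) (i m : ℕ) (x : ℕ → ℝ) : ℝ :=
  Real.exp ((∑ j ∈ (Finset.range m).erase i, (obs σ μ x j) ^ 2) / (4 * σ ^ 2) - m / 2)

lemma partialWeight_pos (μ : ℕ → ℝ) (i m : ℕ) (x : ℕ → ℝ) : 0 < partialWeight σ μ i m x :=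
  Real.exp_pos _

lemma exp_riskEst_of_lt (hσ : 0 < σ) {μ x : ℕ → ℝ} {i m : ℕ} (h : i < m) :
    Real.exp (-(riskEst σ m (obs σ μ x) / (4 * σ ^ 2))) =
      partialWeight σ μ i m x * Real.exp ((obs σ μ x i) ^ 2 / (4 * σ ^ 2)) := by
  unfold partialWeight riskEst
  rw [← Real.exp_add, ← Finset.sum_erase_add _ _ (Finset.mem_range.2 h)]
  congr 1
  field_simp
  ring

lemma exp_riskEst_of_le (hσ : 0 < σ) {μ x : ℕ → ℝ} {i m : ℕ} (h : m ≤ i) :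
    Real.exp (-(riskEst σ m (obs σ μ x) / (4 * σ ^ 2))) = partialWeight σ μ i m x := by
  unfold partialWeight riskEst
  rw [Finset.erase_eq_of_notMem (by simpa using h)]
  congr 1
  field_simp
  ring

/-- The total partial weight of the models that keep the coordinate `i`. -/
noncomputable def keepWeight (σ : ℝ) (M : Finset ℕ) (μ : ℕ → ℝ) (i : ℕ) (x : ℕ → ℝ) : ℝ :=
  ∑ m ∈ M with i < m, partialWeight σ μ i m x

/-- The total partial weight of the models that drop the coordinate `i`. -/
noncomputable def dropWeight (σ : ℝ) (M : Finset ℕ) (μ : ℕ → ℝ) (i : ℕ) (x : ℕ → ℝ) : ℝ :=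
  ∑ m ∈ M with ¬ i < m, partialWeight σ μ i m x

lemma dropWeight_nonneg (μ : ℕ → ℝ) (i : ℕ) (x : ℕ → ℝ) : 0 ≤ dropWeight σ M μ i x :=
  Finset.sum_nonneg fun _ _ => (partialWeight_pos _ _ _ _).le

lemma keepWeight_pos (hM : M.Nonempty) {i : ℕ} (hi : i < M.max' hM) (μ : ℕ → ℝ) (x : ℕ → ℝ) :
    0 < keepWeight σ M μ i x :=
  Finset.sum_pos (fun _ _ => partialWeight_pos _ _ _ _)
    ⟨M.max' hM, Finset.mem_filter.2 ⟨M.max'_mem hM, hi⟩⟩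

lemma sum_expWeight_eq_shrink (hσ : 0 < σ) (μ x : ℕ → ℝ) (i : ℕ) :
    ∑ m ∈ M with i < m, expWeight σ M (obs σ μ x) m =
      shrink σ (keepWeight σ M μ i x) (dropWeight σ M μ i x) (obs σ μ x i) := by
  have h1 : ∑ m ∈ M with i < m, Real.exp (-(riskEst σ m (obs σ μ x) / (4 * σ ^ 2))) =
      keepWeight σ M μ i x * Real.exp ((obs σ μ x i) ^ 2 / (4 * σ ^ 2)) := by
    unfold keepWeight
    rw [Finset.sum_mul]
    exact Finset.sum_congr rfl fun m hm => exp_riskEst_of_lt hσ (Finset.mem_filter.1 hm).2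
  have h2 : ∑ m ∈ M with ¬ i < m, Real.exp (-(riskEst σ m (obs σ μ x) / (4 * σ ^ 2))) =
      dropWeight σ M μ i x :=
    Finset.sum_congr rfl fun m hm =>
      exp_riskEst_of_le hσ (not_lt.1 (Finset.mem_filter.1 hm).2)
  unfold expWeight shrink
  rw [← Finset.sum_div, h1, ← Finset.sum_filter_add_sum_filter_not M (i < ·), h1, h2]

lemma combEst_eq (i : ℕ) :
    combEst M (expWeight σ M) y i = (∑ m ∈ M with i < m, expWeight σ M y m) * y i := by
  unfold combEst projEst
  rw [Finset.sum_mul, Finset.sum_filter]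
  exact Finset.sum_congr rfl fun m _ => by split_ifs <;> simp

lemma combEst_of_max_le (hM : M.Nonempty) {i : ℕ} (hi : M.max' hM ≤ i) :
    combEst M (expWeight σ M) y i = 0 := by
  rw [combEst_eq, Finset.filter_false_of_mem, Finset.sum_empty, zero_mul]
  intro m hm
  exact not_lt.2 ((M.le_max' m hm).trans hi)

lemma riskEst_eq_sum (m : ℕ) : riskEst σ m y = ∑ i ∈ Finset.range m, (2 * σ ^ 2 - y i ^ 2) := by
  unfold riskEst
  rw [Finset.sum_sub_distrib, Finset.sum_const, Finset.card_range, nsmul_eq_mul]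
  ring

lemma sum_range_max_eq (hM : M.Nonempty) :
    ∑ i ∈ Finset.range (M.max' hM),
        (∑ m ∈ M with i < m, expWeight σ M y m) * (2 * σ ^ 2 - y i ^ 2) =
      ∑ m ∈ M, expWeight σ M y m * riskEst σ m y := by
  simp_rw [Finset.sum_filter, Finset.sum_mul]
  rw [Finset.sum_comm]
  refine Finset.sum_congr rfl fun m hm => ?_
  have hsub : Finset.range m ⊆ Finset.range (M.max' hM) :=
    Finset.range_subset_range.2 (M.le_max' m hm)
  rw [riskEst_eq_sum, Finset.mul_sum, ← Finset.sum_subset hsub]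
  · exact Finset.sum_congr rfl fun i hi => by rw [if_pos (Finset.mem_range.1 hi)]
  · intro i _ hi
    rw [if_neg (by simpa using hi), zero_mul]

end weights

section probability

variable {Ω : Type*} [MeasurableSpace Ω] {P : Measure Ω}
  {ξ : ℕ → Ω → ℝ} {σ : ℝ} {μ : ℕ → ℝ} {M : Finset ℕ}

lemma measurable_partialWeight (i m : ℕ) : Measurable (partialWeight σ μ i m) := by
  unfold partialWeight obs; fun_prop

lemma measurable_keepWeight (i : ℕ) : Measurable (keepWeight σ M μ i) := by
  unfold keepWeight
  exact Finset.measurable_sum _ fun m _ => measurable_partialWeight i m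

lemma measurable_dropWeight (i : ℕ) : Measurable (dropWeight σ M μ i) := by
  unfold dropWeight
  exact Finset.measurable_sum _ fun m _ => measurable_partialWeight i m

lemma indepFun_keepWeight_dropWeight (mξ : ∀ i, Measurable (ξ i)) (hind : iIndepFun ξ P) (i : ℕ) :
    IndepFun (ξ i) (fun ω => (keepWeight σ M μ i (fun j => ξ j ω),
      dropWeight σ M μ i (fun j => ξ j ω))) P := by
  -- Only the finitely many coordinates in `T` enter the weights; they are independent of `ξ i`.
  set T : Finset ℕ := (Finset.range (M.sup id)).erase i
  have h := hind.indepFun_finset {i} T (by simp [T]) mξ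
  let ext : (T → ℝ) → ℕ → ℝ := fun z j => if h : j ∈ T then z ⟨j, h⟩ else 0
  have mext : Measurable ext := by
    refine measurable_pi_lambda _ fun j => ?_
    by_cases hj : j ∈ T
    · simp only [ext, hj, dite_true]; fun_prop
    · simp only [ext, hj, dite_false]; fun_prop
  have hpart : ∀ ω, ∀ m ∈ M, partialWeight σ μ i m (fun j => ξ j ω) =
      partialWeight σ μ i m (ext fun j => ξ j ω) := by
    intro ω m hm
    unfold partialWeight
    congr 3
    refine Finset.sum_congr rfl fun j hj => ?_
    have hj' : j ∈ T := by
      have : m ≤ M.sup id := Finset.le_sup (f := id) hm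
      simp only [T, Finset.mem_erase, Finset.mem_range] at hj ⊢
      exact ⟨hj.1, hj.2.trans_le this⟩
    simp [obs, ext, hj']
  have m1 : Measurable fun z : ({i} : Finset ℕ) → ℝ => z ⟨i, Finset.mem_singleton_self i⟩ :=
    measurable_pi_apply _
  have m2 : Measurable fun z => (keepWeight σ M μ i (ext z), dropWeight σ M μ i (ext z)) :=
    ((measurable_keepWeight i).comp mext).prodMk ((measurable_dropWeight i).comp mext)
  have h2 := h.comp m1 m2
  convert! h2 using 1
  ext ω : 1
  simp only [Function.comp_apply, keepWeight, dropWeight]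
  congr 1 <;>
  exact Finset.sum_congr rfl fun m hm => hpart ω m (Finset.mem_filter.1 hm).1

lemma measurable_riskEst (mξ : ∀ i, Measurable (ξ i)) (m : ℕ) :
    Measurable (fun ω => riskEst σ m (obs σ μ (fun j => ξ j ω))) := by
  unfold riskEst obs; fun_prop

lemma measurable_expWeight (mξ : ∀ i, Measurable (ξ i)) (m : ℕ) :
    Measurable (fun ω => expWeight σ M (obs σ μ (fun j => ξ j ω)) m) := by
  unfold expWeight
  have := fun m => measurable_riskEst (σ := σ) (μ := μ) mξ m
  fun_prop

lemma integrable_obs_sq (hlaw : ∀ i, HasLaw (ξ i) (gaussianReal 0 1) P) (i : ℕ) :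
    Integrable (fun ω => obs σ μ (fun j => ξ j ω) i ^ 2) P := by
  have := integrable_comp_of_hasLaw (hlaw i) (integrable_quadratic_gaussianReal (μ i) σ 1 0)
  simpa [obs] using this

lemma integral_obs_sq (hlaw : ∀ i, HasLaw (ξ i) (gaussianReal 0 1) P) (i : ℕ) :
    ∫ ω, obs σ μ (fun j => ξ j ω) i ^ 2 ∂P = μ i ^ 2 + σ ^ 2 := by
  have h1 : Integrable (fun x : ℝ => x) (gaussianReal 0 1) :=
    (memLp_id_gaussianReal 1).integrable le_rfl
  have h2 : ∫ x : ℝ, x ^ 2 ∂(gaussianReal 0 1) = 1 := by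
    have := variance_fun_id_gaussianReal (μ := 0) (v := 1)
    rw [variance_of_integral_eq_zero (by fun_prop) integral_id_gaussianReal] at this
    simpa using this
  have e : ∫ ω, obs σ μ (fun j => ξ j ω) i ^ 2 ∂P =
      ∫ x, (μ i + σ * x) ^ 2 ∂(gaussianReal 0 1) :=
    (hlaw i).integral_comp (f := fun x => (μ i + σ * x) ^ 2) (by fun_prop)
  have h3 : Integrable (fun x : ℝ => μ i ^ 2 + 2 * μ i * σ * x) (gaussianReal 0 1) :=
    (integrable_const _).add (h1.const_mul _)
  have e2 : ∀ x : ℝ, (μ i + σ * x) ^ 2 = (μ i ^ 2 + 2 * μ i * σ * x) + σ ^ 2 * x ^ 2 := by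
    intro x; ring
  rw [e]
  simp_rw [e2]
  rw [integral_add h3
    (integrable_sq_gaussianReal.const_mul _), integral_add (integrable_const _) (h1.const_mul _),
    integral_const_mul, integral_const_mul, h2, integral_id_gaussianReal]
  simp

variable [IsProbabilityMeasure P]

lemma integrable_riskEst (hlaw : ∀ i, HasLaw (ξ i) (gaussianReal 0 1) P) (m : ℕ) :
    Integrable (fun ω => riskEst σ m (obs σ μ (fun j => ξ j ω))) P := by
  unfold riskEst
  exact (integrable_finsetSum _ fun i _ => integrable_obs_sq hlaw i).neg.add (integrable_const _)

lemma integral_riskEst (hlaw : ∀ i, HasLaw (ξ i) (gaussianReal 0 1) P) (m : ℕ) :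
    ∫ ω, riskEst σ m (obs σ μ (fun j => ξ j ω)) ∂P =
      σ ^ 2 * m - ∑ i ∈ Finset.range m, μ i ^ 2 := by
  unfold riskEst
  have h : Integrable (fun ω => -∑ i ∈ Finset.range m, obs σ μ (fun j => ξ j ω) i ^ 2) P :=
    (integrable_finsetSum _ fun i _ => integrable_obs_sq hlaw i).neg
  rw [integral_add h (integrable_const _), integral_neg,
    integral_finsetSum _ fun i _ => integrable_obs_sq hlaw i]
  simp_rw [integral_obs_sq hlaw]
  rw [Finset.sum_add_distrib]
  simp
  ring

lemma integrable_expWeight_mul_riskEst (mξ : ∀ i, Measurable (ξ i))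
    (hlaw : ∀ i, HasLaw (ξ i) (gaussianReal 0 1) P) (hM : M.Nonempty) {m : ℕ} (hm : m ∈ M) (k : ℕ) :
    Integrable (fun ω => expWeight σ M (obs σ μ (fun j => ξ j ω)) m *
      riskEst σ k (obs σ μ (fun j => ξ j ω))) P := by
  refine (integrable_riskEst hlaw k).bdd_mul (c := 1)
    (measurable_expWeight mξ m).aestronglyMeasurable (Filter.Eventually.of_forall fun ω => ?_)
  rw [Real.norm_eq_abs, abs_of_nonneg (expWeight_nonneg _)]
  exact expWeight_le_one hM hm

lemma steinGap_eq (hσ : 0 < σ) (x : ℕ → ℝ) (i : ℕ) :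
    steinGap σ (μ i) (keepWeight σ M μ i x) (dropWeight σ M μ i x) (x i) =
      (combEst M (expWeight σ M) (obs σ μ x) i - μ i) ^ 2 -
      (obs σ μ x i ^ 2 - σ ^ 2 + (∑ m ∈ M with i < m, expWeight σ M (obs σ μ x) m) *
        (2 * σ ^ 2 - obs σ μ x i ^ 2)) := by
  rw [combEst_eq, sum_expWeight_eq_shrink hσ]
  rfl

lemma integrable_shrink_mul (mξ : ∀ i, Measurable (ξ i))
    (hlaw : ∀ i, HasLaw (ξ i) (gaussianReal 0 1) P) (hM : M.Nonempty) (i : ℕ) :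
    Integrable (fun ω => (∑ m ∈ M with i < m, expWeight σ M (obs σ μ (fun j => ξ j ω)) m) *
        (2 * σ ^ 2 - obs σ μ (fun j => ξ j ω) i ^ 2)) P := by
  refine ((integrable_const _).sub (integrable_obs_sq hlaw i)).bdd_mul (c := 1)
    (Finset.measurable_sum _ fun m _ => measurable_expWeight mξ m).aestronglyMeasurable
    (Filter.Eventually.of_forall fun ω => ?_)
  rw [Real.norm_eq_abs, abs_of_nonneg (Finset.sum_nonneg fun _ _ => expWeight_nonneg _),
    ← sum_expWeight (σ := σ) (y := obs σ μ (fun j => ξ j ω)) hM]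
  exact Finset.sum_le_sum_of_subset_of_nonneg (Finset.filter_subset _ _)
    fun _ _ _ => expWeight_nonneg _

lemma integrable_combEst_sub_sq (mξ : ∀ i, Measurable (ξ i))
    (hlaw : ∀ i, HasLaw (ξ i) (gaussianReal 0 1) P) (hσ : 0 < σ) (hM : M.Nonempty) {i : ℕ}
    (hi : i < M.max' hM) :
    Integrable (fun ω =>
      (combEst M (expWeight σ M) (obs σ μ (fun j => ξ j ω)) i - μ i) ^ 2) P := by
  have mx : Measurable (fun ω (j : ℕ) => ξ j ω) := measurable_pi_lambda _ mξ
  have h := integrable_steinGap_comp (σ := σ) (hlaw i) (mξ i)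
    ((measurable_keepWeight (σ := σ) (μ := μ) (M := M) i).comp mx)
    ((measurable_dropWeight (σ := σ) (μ := μ) (M := M) i).comp mx)
    (fun ω => keepWeight_pos hM hi _ _) (fun ω => dropWeight_nonneg _ _ _) (μ i)
  have h2 := h.add (((integrable_obs_sq (σ := σ) (μ := μ) hlaw i).sub
    (integrable_const (σ ^ 2))).add (integrable_shrink_mul (σ := σ) (μ := μ) mξ hlaw hM i))
  refine h2.congr (Filter.Eventually.of_forall fun ω => ?_)
  simp only [Pi.add_apply, Pi.sub_apply, Function.comp_apply,
    steinGap_eq hσ (fun j => ξ j ω) i]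
  ring

lemma integral_combEst_sub_sq (mξ : ∀ i, Measurable (ξ i))
    (hlaw : ∀ i, HasLaw (ξ i) (gaussianReal 0 1) P) (hind : iIndepFun ξ P) (hσ : 0 < σ)
    (hM : M.Nonempty) {i : ℕ} (hi : i < M.max' hM) :
    ∫ ω, (combEst M (expWeight σ M) (obs σ μ (fun j => ξ j ω)) i - μ i) ^ 2 ∂P =
      μ i ^ 2 + ∫ ω, (∑ m ∈ M with i < m, expWeight σ M (obs σ μ (fun j => ξ j ω)) m) *
        (2 * σ ^ 2 - obs σ μ (fun j => ξ j ω) i ^ 2) ∂P := by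
  have mx : Measurable (fun ω (j : ℕ) => ξ j ω) := measurable_pi_lambda _ mξ
  have h := integral_steinGap_comp (σ := σ) hσ (hlaw i) (mξ i)
    ((measurable_keepWeight (σ := σ) (μ := μ) (M := M) i).comp mx)
    ((measurable_dropWeight (σ := σ) (μ := μ) (M := M) i).comp mx)
    (fun ω => keepWeight_pos hM hi _ _) (fun ω => dropWeight_nonneg _ _ _)
    (indepFun_keepWeight_dropWeight mξ hind i) (μ i)
  simp only [Function.comp_apply, fun ω => steinGap_eq (μ := μ) (M := M) hσ (fun j => ξ j ω) i] at h
  have i1 : Integrable (fun ω => obs σ μ (fun j => ξ j ω) i ^ 2 - σ ^ 2) P :=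
    (integrable_obs_sq hlaw i).sub (integrable_const _)
  have i2 := integrable_shrink_mul (σ := σ) (μ := μ) mξ hlaw hM i
  have i12 : Integrable (fun ω => obs σ μ (fun j => ξ j ω) i ^ 2 - σ ^ 2 +
      (∑ m ∈ M with i < m, expWeight σ M (obs σ μ (fun j => ξ j ω)) m) *
        (2 * σ ^ 2 - obs σ μ (fun j => ξ j ω) i ^ 2)) P := i1.add i2
  rw [integral_sub (integrable_combEst_sub_sq mξ hlaw hσ hM hi) i12, integral_add i1 i2,
    integral_sub (integrable_obs_sq hlaw i) (integrable_const _), integral_obs_sq hlaw] at h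
  simp only [integral_const, probReal_univ, smul_eq_mul, one_mul] at h
  linarith

/-- The mean square risk of the exponentially weighted estimator is the mean of the weighted
unbiased risk estimates: the variance of the models under the weights, which the squared error
carries with a minus sign, is compensated by the derivative of the weights. -/
lemma risk_eq (mξ : ∀ i, Measurable (ξ i))
    (hlaw : ∀ i, HasLaw (ξ i) (gaussianReal 0 1) P) (hind : iIndepFun ξ P) (hσ : 0 < σ)
    (hμ : Summable fun i => μ i ^ 2) (hM : M.Nonempty) :
    risk P ξ σ μ (combEst M (expWeight σ M)) = ENNReal.ofReal (∑' i, μ i ^ 2 +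
      ∫ ω, ∑ m ∈ M, expWeight σ M (obs σ μ (fun j => ξ j ω)) m *
        riskEst σ m (obs σ μ (fun j => ξ j ω)) ∂P) := by
  set N := M.max' hM with hN
  have hμN : Summable fun i => μ (i + N) ^ 2 := (summable_nat_add_iff N).2 hμ
  have htail : ∀ ω i, (combEst M (expWeight σ M) (obs σ μ (fun j => ξ j ω)) (i + N) - μ (i + N)) ^ 2
      = μ (i + N) ^ 2 := by
    intro ω i
    rw [combEst_of_max_le hM (by omega)]; ring
  have hsum : ∀ ω, Summable fun i =>
      (combEst M (expWeight σ M) (obs σ μ (fun j => ξ j ω)) i - μ i) ^ 2 := by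
    intro ω
    rw [← summable_nat_add_iff N]
    simpa only [htail] using hμN
  have hloss : ∀ ω, ∑' i, (combEst M (expWeight σ M) (obs σ μ (fun j => ξ j ω)) i - μ i) ^ 2 =
      ∑ i ∈ Finset.range N, (combEst M (expWeight σ M) (obs σ μ (fun j => ξ j ω)) i - μ i) ^ 2 +
        ∑' i, μ (i + N) ^ 2 := by
    intro ω
    rw [← (hsum ω).sum_add_tsum_nat_add N]
    simp only [htail]
  have hint : Integrable (fun ω => ∑ i ∈ Finset.range N,
      (combEst M (expWeight σ M) (obs σ μ (fun j => ξ j ω)) i - μ i) ^ 2) P :=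
    integrable_finsetSum _ fun i hi =>
      integrable_combEst_sub_sq mξ hlaw hσ hM (Finset.mem_range.1 hi)
  have e1 : risk P ξ σ μ (combEst M (expWeight σ M)) =
      ∫⁻ ω, ENNReal.ofReal (∑ i ∈ Finset.range N,
        (combEst M (expWeight σ M) (obs σ μ (fun j => ξ j ω)) i - μ i) ^ 2 +
        ∑' i, μ (i + N) ^ 2) ∂P := by
    unfold risk
    refine lintegral_congr fun ω => ?_
    rw [← hloss, ENNReal.ofReal_tsum_of_nonneg (fun _ => sq_nonneg _) (hsum ω)]
  have hint' : Integrable (fun ω => ∑ i ∈ Finset.range N,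
      (combEst M (expWeight σ M) (obs σ μ (fun j => ξ j ω)) i - μ i) ^ 2 +
        ∑' i, μ (i + N) ^ 2) P := hint.add (integrable_const _)
  rw [e1, ← ofReal_integral_eq_lintegral_ofReal hint'
    (Filter.Eventually.of_forall fun ω => add_nonneg
      (Finset.sum_nonneg fun _ _ => sq_nonneg _) (tsum_nonneg fun _ => sq_nonneg _)),
    integral_add hint (integrable_const _), integral_finsetSum _ fun i hi =>
      integrable_combEst_sub_sq mξ hlaw hσ hM (Finset.mem_range.1 hi),
    Finset.sum_congr rfl fun i hi =>
      integral_combEst_sub_sq mξ hlaw hind hσ hM (Finset.mem_range.1 hi),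
    Finset.sum_add_distrib, ← integral_finsetSum _ fun i _ => integrable_shrink_mul mξ hlaw hM i,
    ← hμ.sum_add_tsum_nat_add N]
  simp_rw [hN, sum_range_max_eq hM]
  simp only [integral_const, probReal_univ, smul_eq_mul, one_mul]
  congr 1
  ring

end probability

/-! ### Entropy of the exponential weights -/

lemma mul_exp_neg_le {θ d : ℝ} (hθ : θ ≤ 1 / 2) (hd : 0 ≤ d) :
    d * Real.exp (-d) ≤ 2 * Real.exp (-(θ * d)) := by
  have h1 : d ≤ 2 * Real.exp ((1 - θ) * d) := by
    have := Real.add_one_le_exp ((1 - θ) * d)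
    nlinarith
  calc d * Real.exp (-d) ≤ 2 * Real.exp ((1 - θ) * d) * Real.exp (-d) := by gcongr
    _ = 2 * Real.exp (-(θ * d)) := by
      rw [mul_assoc, ← Real.exp_add]; congr 2; ring

/-- Under the weights proportional to `exp (-d m)`, the mean of `d` is at most the logarithm of the
number of indices outside `s`, up to an error that is small when `d` is large on `s`. -/
lemma sum_gibbs_mul_le {M s : Finset ℕ} {d : ℕ → ℝ} {m₀ : ℕ} (hm₀ : m₀ ∈ M) (hd : d m₀ = 0)
    (hs : s ⊆ M) {L θ : ℝ} (hL : 1 ≤ L) (hcard : ((M \ s).card : ℝ) ≤ L) (hθ0 : 0 < θ)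
    (hθ : θ ≤ 1 / 2) :
    ∑ m ∈ M, Real.exp (-d m) / (∑ k ∈ M, Real.exp (-d k)) * d m ≤
      Real.log L + 3 * ∑ m ∈ s, Real.exp (-(θ * d m)) := by
  set Z := ∑ k ∈ M, Real.exp (-d k) with hZdef
  have hZ1 : 1 ≤ Z := by
    have := Finset.single_le_sum (f := fun k => Real.exp (-d k))
      (fun _ _ => (Real.exp_pos _).le) hm₀
    simpa [hd] using this
  have hZ : 0 < Z := by linarith
  set w : ℕ → ℝ := fun m => Real.exp (-d m) / Z with hw
  have hw0 : ∀ m, 0 < w m := fun m => div_pos (Real.exp_pos _) hZ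
  have hwle : ∀ m, w m ≤ Real.exp (-d m) := fun m => div_le_self (Real.exp_pos _).le hZ1
  have hwsum : ∑ m ∈ M, w m = 1 := by
    rw [hw, ← Finset.sum_div]; exact div_self hZ.ne'
  have hw1 : ∀ m ∈ M, w m ≤ 1 := fun m hm => by
    rw [← hwsum]
    exact Finset.single_le_sum (f := w) (fun _ _ => (hw0 _).le) hm
  -- On `s` both `w` and `w * d` are controlled by `exp (-(θ * d))`, whatever the sign of `d`.
  have hsw : ∑ m ∈ s, w m ≤ ∑ m ∈ s, Real.exp (-(θ * d m)) := by
    refine Finset.sum_le_sum fun m hm => ?_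
    rcases le_total 0 (d m) with h | h
    · exact (hwle m).trans (Real.exp_le_exp.2 (by nlinarith))
    · exact (hw1 m (hs hm)).trans (Real.one_le_exp (by nlinarith))
  have hswd : ∑ m ∈ s, w m * d m ≤ 2 * ∑ m ∈ s, Real.exp (-(θ * d m)) := by
    rw [Finset.mul_sum]
    refine Finset.sum_le_sum fun m hm => ?_
    rcases le_total 0 (d m) with h | h
    · calc w m * d m ≤ Real.exp (-d m) * d m := mul_le_mul_of_nonneg_right (hwle m) h
        _ = d m * Real.exp (-d m) := mul_comm _ _
        _ ≤ _ := mul_exp_neg_le hθ h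
    · exact (mul_nonpos_of_nonneg_of_nonpos (hw0 m).le h).trans (by positivity)
  -- Off `s`, `d ≤ -log w` since the normalising constant is at least one.
  have hcw : ∀ m, w m * d m ≤ w m * Real.log L + (1 / L - w m) := by
    intro m
    have h1 : d m ≤ -Real.log (w m) := by
      rw [hw]
      simp only
      rw [Real.log_div (Real.exp_pos _).ne' hZ.ne', Real.log_exp]
      have := Real.log_nonneg hZ1
      linarith
    have h2 := Real.log_le_sub_one_of_pos (x := 1 / (L * w m))
      (one_div_pos.2 (mul_pos (by linarith) (hw0 m)))
    rw [one_div, Real.log_inv, Real.log_mul (by linarith) (hw0 m).ne'] at h2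
    have h3 : w m * d m ≤ w m * (Real.log L + ((L * w m)⁻¹ - 1)) :=
      mul_le_mul_of_nonneg_left (by linarith) (hw0 m).le
    refine h3.trans_eq ?_
    have := (hw0 m).ne'
    have : L ≠ 0 := by linarith
    field_simp
  have hc : ∑ m ∈ M \ s, w m * d m ≤
      (∑ m ∈ M \ s, w m) * Real.log L + (1 - ∑ m ∈ M \ s, w m) := by
    refine (Finset.sum_le_sum fun m _ => hcw m).trans ?_
    rw [Finset.sum_add_distrib, Finset.sum_sub_distrib, Finset.sum_const, nsmul_eq_mul,
      ← Finset.sum_mul]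
    have : ((M \ s).card : ℝ) * (1 / L) ≤ 1 := by
      rw [mul_one_div, div_le_one (by linarith)]; exact hcard
    linarith
  have hsplit := Finset.sum_sdiff (f := w) hs
  have hlog := Real.log_nonneg hL
  have hs0 : 0 ≤ ∑ m ∈ s, w m := Finset.sum_nonneg fun m _ => (hw0 m).le
  rw [hwsum] at hsplit
  have : (∑ m ∈ M \ s, w m) * Real.log L ≤ Real.log L :=
    mul_le_of_le_one_left hlog (by linarith)
  rw [← Finset.sum_sdiff (f := fun m => w m * d m) hs]
  linarith

/-! ### Exponential moments of squared normal variables -/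

lemma gaussianPDFReal_mul_exp_sq {t : ℝ} (ht : t < 1 / 2) (a x : ℝ) :
    gaussianPDFReal 0 1 x * Real.exp (t * ((a + x) ^ 2 - 2)) =
      Real.exp (t * a ^ 2 / (1 - 2 * t) - 2 * t) / √(1 - 2 * t) *
        gaussianPDFReal (2 * t * a / (1 - 2 * t)) (Real.toNNReal (1 / (1 - 2 * t))) x := by
  have hc : 0 < 1 - 2 * t := by linarith
  rw [gaussianPDFReal, gaussianPDFReal, Real.coe_toNNReal _ (by positivity), NNReal.coe_one,
    mul_one_div, Real.sqrt_div (by positivity), mul_assoc, ← Real.exp_add]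
  have h1 : √(1 - 2 * t) ≠ 0 := (Real.sqrt_pos.2 hc).ne'
  have h2 : √(2 * Real.pi) ≠ 0 := (Real.sqrt_pos.2 (by positivity)).ne'
  have key : -(x - 0) ^ 2 / (2 * 1) + t * ((a + x) ^ 2 - 2) =
      (t * a ^ 2 / (1 - 2 * t) - 2 * t) +
        -(x - 2 * t * a / (1 - 2 * t)) ^ 2 / (2 * (1 / (1 - 2 * t))) := by
    field_simp
    ring
  rw [mul_one, key, Real.exp_add]
  field_simp

lemma integrable_exp_sq_gaussianReal {t : ℝ} (ht : t < 1 / 2) (a : ℝ) :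
    Integrable (fun x => Real.exp (t * ((a + x) ^ 2 - 2))) (gaussianReal 0 1) := by
  rw [integrable_gaussianReal_iff]
  simp_rw [gaussianPDFReal_mul_exp_sq ht]
  exact (integrable_gaussianPDFReal _ _).const_mul _

lemma integral_exp_sq_gaussianReal_le {t : ℝ} (ht : t < 1 / 2) (a : ℝ) :
    ∫ x, Real.exp (t * ((a + x) ^ 2 - 2)) ∂(gaussianReal 0 1) ≤
      Real.exp (t / (1 - 2 * t) * (1 + a ^ 2) - 2 * t) := by
  have hc : 0 < 1 - 2 * t := by linarith
  rw [integral_gaussianReal_eq_integral_smul one_ne_zero]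
  simp_rw [smul_eq_mul, gaussianPDFReal_mul_exp_sq ht]
  rw [integral_const_mul, integral_gaussianPDFReal_eq_one _
    (Real.toNNReal_pos.2 (by positivity)).ne', mul_one]
  -- `1 / (1 - 2 t) = 1 + 2 t / (1 - 2 t) ≤ exp (2 t / (1 - 2 t))`
  have h1 : (√(1 - 2 * t))⁻¹ ≤ Real.exp (t / (1 - 2 * t)) := by
    rw [← Real.sqrt_inv]
    refine Real.sqrt_le_iff.2 ⟨(Real.exp_pos _).le, ?_⟩
    rw [← Real.exp_nat_mul]
    have := Real.add_one_le_exp ((2 : ℕ) * (t / (1 - 2 * t)))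
    refine le_trans (le_of_eq ?_) this
    push_cast
    field_simp
    ring
  calc _ = Real.exp (t * a ^ 2 / (1 - 2 * t) - 2 * t) * (√(1 - 2 * t))⁻¹ := div_eq_mul_inv _ _
    _ ≤ Real.exp (t * a ^ 2 / (1 - 2 * t) - 2 * t) * Real.exp (t / (1 - 2 * t)) := by gcongr
    _ = _ := by
      rw [← Real.exp_add]; congr 1; ring

section probability

variable {Ω : Type*} [MeasurableSpace Ω] {P : Measure Ω} [IsProbabilityMeasure P]
  {ξ : ℕ → Ω → ℝ} {σ : ℝ} {μ : ℕ → ℝ} {M : Finset ℕ}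

lemma riskEst_sub_riskEst (hσ : 0 < σ) {m₀ m : ℕ} (h : m₀ ≤ m) (x : ℕ → ℝ) :
    riskEst σ m (obs σ μ x) - riskEst σ m₀ (obs σ μ x) =
      -(σ ^ 2 * ∑ i ∈ Finset.Ico m₀ m, ((μ i / σ + x i) ^ 2 - 2)) := by
  rw [riskEst_eq_sum, riskEst_eq_sum, ← Finset.sum_Ico_eq_sub _ h, Finset.mul_sum,
    ← Finset.sum_neg_distrib]
  refine Finset.sum_congr rfl fun i _ => ?_
  unfold obs
  field_simp
  ring

lemma neg_mul_riskDiff_eq (hσ : 0 < σ) {m₀ m : ℕ} (h : m₀ ≤ m) (θ : ℝ) (x : ℕ → ℝ) :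
    -(θ * ((riskEst σ m (obs σ μ x) - riskEst σ m₀ (obs σ μ x)) / (4 * σ ^ 2))) =
      θ / 4 * ∑ i ∈ Finset.Ico m₀ m, ((μ i / σ + x i) ^ 2 - 2) := by
  rw [riskEst_sub_riskEst hσ h]
  field_simp

/-- Exponential moment of the loss in estimated risk from replacing `m₀` by a larger model `m`. -/
lemma integral_exp_riskDiff_le (mξ : ∀ i, Measurable (ξ i))
    (hlaw : ∀ i, HasLaw (ξ i) (gaussianReal 0 1) P) (hind : iIndepFun ξ P) (hσ : 0 < σ)
    {m₀ m : ℕ} (h : m₀ ≤ m) {θ : ℝ} (hθ : θ < 2) :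
    Integrable (fun ω => Real.exp (-(θ * ((riskEst σ m (obs σ μ (fun j => ξ j ω)) -
      riskEst σ m₀ (obs σ μ (fun j => ξ j ω))) / (4 * σ ^ 2))))) P ∧
    ∫ ω, Real.exp (-(θ * ((riskEst σ m (obs σ μ (fun j => ξ j ω)) -
      riskEst σ m₀ (obs σ μ (fun j => ξ j ω))) / (4 * σ ^ 2)))) ∂P ≤
      Real.exp (θ / 4 / (1 - θ / 2) *
        (((m : ℝ) - m₀) + ∑ i ∈ Finset.Ico m₀ m, (μ i / σ) ^ 2) - θ / 2 * ((m : ℝ) - m₀)) := by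
  simp_rw [neg_mul_riskDiff_eq hσ h]
  have ht : θ / 4 < 1 / 2 := by linarith
  set X : ℕ → Ω → ℝ := fun i ω => (μ i / σ + ξ i ω) ^ 2 - 2 with hX
  have mX : ∀ i, Measurable (X i) := fun i => by simp only [hX]; fun_prop
  have hXind : iIndepFun X P :=
    hind.comp (fun i x => (μ i / σ + x) ^ 2 - 2) fun i => by fun_prop
  have hXint : ∀ i, Integrable (fun ω => Real.exp (θ / 4 * X i ω)) P := fun i =>
    integrable_comp_of_hasLaw (hlaw i) (integrable_exp_sq_gaussianReal ht (μ i / σ))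
  have hXle : ∀ i, mgf (X i) P (θ / 4) ≤
      Real.exp (θ / 4 / (1 - 2 * (θ / 4)) * (1 + (μ i / σ) ^ 2) - 2 * (θ / 4)) := by
    intro i
    refine le_trans (le_of_eq ?_) (integral_exp_sq_gaussianReal_le ht (μ i / σ))
    exact (hlaw i).integral_comp (f := fun x => Real.exp (θ / 4 * ((μ i / σ + x) ^ 2 - 2)))
      (by fun_prop)
  have hsum : ∀ ω, ∑ i ∈ Finset.Ico m₀ m, ((μ i / σ + ξ i ω) ^ 2 - 2) =
      (∑ i ∈ Finset.Ico m₀ m, X i) ω := fun ω => by rw [Finset.sum_apply]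
  simp_rw [hsum]
  refine ⟨hXind.integrable_exp_mul_sum mX fun i _ => hXint i, ?_⟩
  change mgf (∑ i ∈ Finset.Ico m₀ m, X i) P (θ / 4) ≤ _
  rw [hXind.mgf_sum mX]
  refine (Finset.prod_le_prod (fun _ _ => mgf_nonneg) fun i _ => hXle i).trans (le_of_eq ?_)
  rw [← Real.exp_sum, Finset.sum_sub_distrib, ← Finset.mul_sum, Finset.sum_add_distrib]
  simp only [Finset.sum_const, Nat.card_Ico, nsmul_eq_mul, Nat.cast_sub h]
  congr 1
  ring

lemma sum_geometric_le {s : Finset ℕ} {m₀ : ℕ} (hs : ∀ m ∈ s, m₀ < m) {c : ℝ} (hc : 0 < c) :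
    ∑ m ∈ s, Real.exp (-(c * ((m : ℝ) - m₀))) ≤ 1 / c := by
  have hq1 : Real.exp (-c) < 1 := by simpa using hc
  have hq0 := Real.exp_pos (-c)
  have hinj : Set.InjOn (fun m : ℕ => m - (m₀ + 1)) s := by
    intro a ha b hb hab
    have := hs a ha
    have := hs b hb
    simp only at hab
    omega
  have hterm : ∀ m ∈ s, Real.exp (-(c * ((m : ℝ) - m₀))) =
      Real.exp (-c) * Real.exp (-c) ^ (m - (m₀ + 1)) := by
    intro m hm
    rw [← pow_succ', ← Real.exp_nat_mul]
    have := hs m hm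
    congr 1
    rw [show m - (m₀ + 1) + 1 = m - m₀ by omega, Nat.cast_sub this.le]
    ring
  rw [Finset.sum_congr rfl hterm, ← Finset.mul_sum,
    ← Finset.sum_image (f := fun n => Real.exp (-c) ^ n) hinj]
  have hsum := (summable_geometric_of_lt_one hq0.le hq1).sum_le_tsum
    (s.image fun m => m - (m₀ + 1)) (fun _ _ => by positivity)
  rw [tsum_geometric_of_lt_one hq0.le hq1] at hsum
  refine (mul_le_mul_of_nonneg_left hsum hq0.le).trans ?_
  rw [← div_eq_mul_inv, div_le_div_iff₀ (by linarith) hc]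
  have h1 : Real.exp (-c) * Real.exp c = 1 := by rw [← Real.exp_add]; simp
  nlinarith [Real.add_one_le_exp c]

/-- When `m - m₀` exceeds the bias of `m₀` by a factor `1 / (1 - 2 * θ)`, the estimated risk of
`m` is above that of `m₀` except with exponentially small probability: each of the `m - m₀` added
coordinates costs `σ ^ 2` on average, and together they cannot recover more than the bias. -/
lemma integral_exp_riskDiff_le_of_large (mξ : ∀ i, Measurable (ξ i))
    (hlaw : ∀ i, HasLaw (ξ i) (gaussianReal 0 1) P) (hind : iIndepFun ξ P) (hσ : 0 < σ)
    (hμ : Summable fun i => μ i ^ 2) {m₀ m : ℕ} (h : m₀ ≤ m) {θ K : ℝ} (hθ0 : 0 < θ)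
    (hθ : θ < 1 / 2) (hK : 0 ≤ K)
    (hm : (∑' i, μ (m₀ + i) ^ 2) / σ ^ 2 + K ≤ (1 - 2 * θ) * ((m : ℝ) - m₀)) :
    ∫ ω, Real.exp (-(θ * ((riskEst σ m (obs σ μ (fun j => ξ j ω)) -
      riskEst σ m₀ (obs σ μ (fun j => ξ j ω))) / (4 * σ ^ 2)))) ∂P ≤
      Real.exp (-(θ / 4 * K)) * Real.exp (-(θ ^ 2 / 4 * ((m : ℝ) - m₀))) := by
  refine (integral_exp_riskDiff_le mξ hlaw hind hσ h (by linarith)).2.trans ?_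
  rw [← Real.exp_add, Real.exp_le_exp]
  have hn : (0 : ℝ) ≤ (m : ℝ) - m₀ := sub_nonneg.2 (by exact_mod_cast h)
  have hbias : ∑ i ∈ Finset.Ico m₀ m, (μ i / σ) ^ 2 ≤ (∑' i, μ (m₀ + i) ^ 2) / σ ^ 2 := by
    simp_rw [div_pow]
    rw [← Finset.sum_div, Finset.sum_Ico_eq_sum_range]
    gcongr
    have hs : Summable fun i => μ (m₀ + i) ^ 2 := by
      simpa only [add_comm] using (summable_nat_add_iff m₀).2 hμ
    exact hs.sum_le_tsum _ fun _ _ => sq_nonneg _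
  set n := (m : ℝ) - m₀
  set b := ∑ i ∈ Finset.Ico m₀ m, (μ i / σ) ^ 2
  have hc : 0 < 1 - θ / 2 := by linarith
  have e1 : θ / 4 / (1 - θ / 2) * (n + b) - θ / 2 * n =
      θ / 4 / (1 - θ / 2) * (b - n + θ * n) := by
    have : 2 - θ ≠ 0 := by linarith
    field_simp
    ring
  have e2 : b - n + θ * n ≤ -(θ * n + K) := by linarith
  have e3 : θ / 4 ≤ θ / 4 / (1 - θ / 2) := le_div_self (by linarith) hc (by linarith)
  have e4 : 0 ≤ θ * n + K := by positivity
  rw [e1]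
  calc _ ≤ θ / 4 / (1 - θ / 2) * (-(θ * n + K)) := mul_le_mul_of_nonneg_left e2 (by linarith)
    _ ≤ θ / 4 * (-(θ * n + K)) := by nlinarith
    _ = _ := by ring

/-- Let `σ ^ 2 * R` be the risk of a fixed model `m₀ ∈ M`. The mean excess of the weighted risk
estimate over that of `m₀`, in units of `4 * σ ^ 2`, is at most the logarithm of a bound on the
number of models of dimension at most `(R + K) / (1 - 2 * θ)`, plus the contribution of the
larger ones. -/
lemma integral_sum_expWeight_mul_riskDiff_le (mξ : ∀ i, Measurable (ξ i))
    (hlaw : ∀ i, HasLaw (ξ i) (gaussianReal 0 1) P) (hind : iIndepFun ξ P) (hσ : 0 < σ)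
    (hμ : Summable fun i => μ i ^ 2) (hM1 : ∀ m ∈ M, 1 ≤ m) {m₀ : ℕ} (hm₀ : m₀ ∈ M)
    {θ K R : ℝ} (hθ0 : 0 < θ) (hθ : θ < 1 / 2) (hK : 0 ≤ K)
    (hR : R = (∑' i, μ (m₀ + i) ^ 2) / σ ^ 2 + m₀) :
    ∫ ω, ∑ m ∈ M, expWeight σ M (obs σ μ (fun j => ξ j ω)) m *
      ((riskEst σ m (obs σ μ (fun j => ξ j ω)) - riskEst σ m₀ (obs σ μ (fun j => ξ j ω))) /
        (4 * σ ^ 2)) ∂P ≤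
      Real.log ((R + K) / (1 - 2 * θ)) + 12 / θ ^ 2 * Real.exp (-(θ / 4 * K)) := by
  set L := (R + K) / (1 - 2 * θ) with hLdef
  have hc : 0 < 1 - 2 * θ := by linarith
  have hbias : 0 ≤ (∑' i, μ (m₀ + i) ^ 2) / σ ^ 2 :=
    div_nonneg (tsum_nonneg fun _ => sq_nonneg _) (sq_nonneg _)
  have hm₀L : (m₀ : ℝ) ≤ L := by
    rw [hLdef, le_div_iff₀ hc]
    have : (0 : ℝ) ≤ m₀ := Nat.cast_nonneg _
    nlinarith
  have hL1 : 1 ≤ L := le_trans (by exact_mod_cast hM1 m₀ hm₀) hm₀L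
  set s : Finset ℕ := M.filter fun m => L < m with hs
  have hsM : s ⊆ M := Finset.filter_subset _ _
  have hlt : ∀ m ∈ s, m₀ < m := fun m hm => by
    have := (Finset.mem_filter.1 hm).2
    exact_mod_cast hm₀L.trans_lt this
  have hcard : ((M \ s).card : ℝ) ≤ L := by
    have hsub : M \ s ⊆ Finset.Icc 1 ⌊L⌋₊ := by
      intro m hm
      simp only [hs, Finset.mem_sdiff, Finset.mem_filter, not_and, not_lt] at hm
      exact Finset.mem_Icc.2 ⟨hM1 m hm.1, Nat.le_floor (hm.2 hm.1)⟩
    have h1 := Finset.card_le_card hsub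
    rw [Nat.card_Icc, Nat.add_sub_cancel] at h1
    exact (Nat.cast_le.2 h1).trans (Nat.floor_le (by linarith))
  set d : Ω → ℕ → ℝ := fun ω m => (riskEst σ m (obs σ μ (fun j => ξ j ω)) -
    riskEst σ m₀ (obs σ μ (fun j => ξ j ω))) / (4 * σ ^ 2) with hd
  have hw : ∀ ω m, expWeight σ M (obs σ μ (fun j => ξ j ω)) m =
      Real.exp (-d ω m) / ∑ k ∈ M, Real.exp (-d ω k) := by
    intro ω m
    -- the common factor `exp (riskEst σ m₀ / (4 σ²))` cancels
    have hfac : ∀ k, Real.exp (-d ω k) =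
        Real.exp (-(riskEst σ k (obs σ μ (fun j => ξ j ω)) / (4 * σ ^ 2))) *
          Real.exp (riskEst σ m₀ (obs σ μ (fun j => ξ j ω)) / (4 * σ ^ 2)) := by
      intro k
      rw [← Real.exp_add]
      congr 1
      simp only [hd]
      ring
    simp_rw [hfac]
    rw [← Finset.sum_mul, mul_div_mul_right _ _ (Real.exp_pos _).ne', expWeight]
  have hpoint : ∀ ω, ∑ m ∈ M, expWeight σ M (obs σ μ (fun j => ξ j ω)) m * d ω m ≤
      Real.log L + 3 * ∑ m ∈ s, Real.exp (-(θ * d ω m)) := by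
    intro ω
    simp_rw [hw]
    exact sum_gibbs_mul_le hm₀ (by simp [hd]) hsM hL1 hcard hθ0 hθ.le
  have hexp : ∀ m ∈ s, Integrable (fun ω => Real.exp (-(θ * d ω m))) P := fun m hm =>
    (integral_exp_riskDiff_le mξ hlaw hind hσ (hlt m hm).le (by linarith)).1
  have hintl : Integrable (fun ω => ∑ m ∈ M,
      expWeight σ M (obs σ μ (fun j => ξ j ω)) m * d ω m) P := by
    refine integrable_finsetSum _ fun m hm => ?_
    have := ((integrable_expWeight_mul_riskEst (σ := σ) (μ := μ) mξ hlaw ⟨m₀, hm₀⟩ hm m).sub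
      (integrable_expWeight_mul_riskEst (σ := σ) (μ := μ) mξ hlaw ⟨m₀, hm₀⟩
        hm m₀)).div_const (4 * σ ^ 2)
    refine this.congr (Filter.Eventually.of_forall fun ω => ?_)
    simp only [hd, Pi.sub_apply]
    ring
  have hintr : Integrable (fun ω => 3 * ∑ m ∈ s, Real.exp (-(θ * d ω m))) P :=
    (integrable_finsetSum _ hexp).const_mul _
  have hintr' : Integrable (fun ω => Real.log L + 3 * ∑ m ∈ s, Real.exp (-(θ * d ω m))) P :=
    (integrable_const _).add hintr
  have h1 := integral_mono hintl hintr' hpoint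
  refine h1.trans ?_
  have e1 : ∫ ω, (Real.log L + 3 * ∑ m ∈ s, Real.exp (-(θ * d ω m))) ∂P =
      Real.log L + 3 * ∑ m ∈ s, ∫ ω, Real.exp (-(θ * d ω m)) ∂P := by
    rw [integral_add (integrable_const _) hintr, integral_const_mul, integral_finsetSum _ hexp]
    simp
  rw [e1]
  have htail : ∑ m ∈ s, ∫ ω, Real.exp (-(θ * d ω m)) ∂P ≤
      Real.exp (-(θ / 4 * K)) * (1 / (θ ^ 2 / 4)) := by
    refine (Finset.sum_le_sum fun m hm => integral_exp_riskDiff_le_of_large mξ hlaw hind hσ hμ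
      (hlt m hm).le hθ0 hθ hK ?_).trans ?_
    · have hLm := (Finset.mem_filter.1 hm).2
      rw [hLdef, div_lt_iff₀ hc] at hLm
      have : (0 : ℝ) ≤ m₀ := Nat.cast_nonneg _
      nlinarith
    · rw [← Finset.mul_sum]
      exact mul_le_mul_of_nonneg_left (sum_geometric_le hlt (by positivity)) (Real.exp_pos _).le
  have e2 : 12 / θ ^ 2 * Real.exp (-(θ / 4 * K)) =
      3 * (Real.exp (-(θ / 4 * K)) * (1 / (θ ^ 2 / 4))) := by
    field_simp
    norm_num
  rw [e2]
  linarith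

end probability

/-! ### The remainder function -/

/-- With `R = r⁻¹` the oracle risk in units of `σ ^ 2`, `1 + remainder r` is `1 / R` times the
bound `L` on the number of models that matter, times the exponential of the bound on the
contribution of the models larger than `L`. The fourth root of `r` is a scale at which both
factors tend to one. The value at `r = 0` is an artefact of `0⁻¹ = 0`. -/
noncomputable def remainder (r : ℝ) : ℝ :=
  (1 + √√r) / (1 - √√r / 2) * Real.exp (192 * ((√r)⁻¹ * Real.exp (-((√r)⁻¹ / 16)))) - 1

lemma remainder_mem {r : ℝ} (hr1 : r ≤ 1) :
    0 ≤ remainder r ∧ remainder r ≤ 4 * Real.exp 3072 := by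
  have hq0 : 0 ≤ √√r := Real.sqrt_nonneg _
  have hq1 : √√r ≤ 1 := Real.sqrt_le_one.2 (Real.sqrt_le_one.2 hr1)
  have hy : 0 ≤ (√r)⁻¹ := inv_nonneg.2 (Real.sqrt_nonneg r)
  set y := (√r)⁻¹
  have hye : y * Real.exp (-(y / 16)) ≤ 16 := by
    have h1 := Real.add_one_le_exp (y / 16)
    have h2 : Real.exp (y / 16) * Real.exp (-(y / 16)) = 1 := by rw [← Real.exp_add]; simp
    have h3 := Real.exp_pos (-(y / 16))
    nlinarith
  have hd : 0 < 1 - √√r / 2 := by linarith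
  have hf1 : 1 ≤ (1 + √√r) / (1 - √√r / 2) := by
    rw [le_div_iff₀ hd]; linarith
  have hf4 : (1 + √√r) / (1 - √√r / 2) ≤ 4 := by
    rw [div_le_iff₀ hd]; linarith
  have he1 : 1 ≤ Real.exp (192 * (y * Real.exp (-(y / 16)))) := Real.one_le_exp (by positivity)
  have he2 : Real.exp (192 * (y * Real.exp (-(y / 16)))) ≤ Real.exp 3072 :=
    Real.exp_le_exp.2 (by linarith)
  unfold remainder
  constructor
  · nlinarith
  · have := mul_le_mul hf4 he2 (by positivity) (by norm_num)
    linarith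

lemma tendsto_remainder : Filter.Tendsto remainder (nhdsWithin 0 (Set.Ioi 0)) (nhds 0) := by
  have hs : Filter.Tendsto (fun r : ℝ => √r) (nhdsWithin 0 (Set.Ioi 0))
      (nhdsWithin 0 (Set.Ioi 0)) := by
    refine tendsto_nhdsWithin_iff.2 ⟨?_, ?_⟩
    · have := (Real.continuous_sqrt.tendsto 0).mono_left
        (nhdsWithin_le_nhds (s := Set.Ioi (0 : ℝ)))
      simpa using this
    · filter_upwards [self_mem_nhdsWithin] with r hr
      exact Real.sqrt_pos.2 hr
  have hq : Filter.Tendsto (fun r : ℝ => √√r) (nhdsWithin 0 (Set.Ioi 0)) (nhds 0) :=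
    (hs.comp hs).mono_right nhdsWithin_le_nhds
  have hy : Filter.Tendsto (fun r : ℝ => (√r)⁻¹ / 16) (nhdsWithin 0 (Set.Ioi 0)) Filter.atTop :=
    (tendsto_inv_nhdsGT_zero.comp hs).atTop_div_const (by norm_num)
  have he := ((Real.tendsto_pow_mul_exp_neg_atTop_nhds_zero 1).comp hy).const_mul (192 * 16)
  have h := ((hq.const_add 1).div ((hq.div_const 2).const_sub 1) (by norm_num)).mul
    ((Real.continuous_exp.tendsto _).comp he)
  have h' := h.sub_const 1
  simp only [add_zero, zero_div, sub_zero, div_one, mul_zero, Real.exp_zero, mul_one,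
    sub_self] at h'
  refine h'.congr fun r => ?_
  simp only [remainder, Function.comp_apply, pow_one, Pi.div_apply]
  congr 3
  ring

lemma log_mul_one_add_remainder {R : ℝ} (hR : 1 ≤ R) :
    Real.log (R * (1 + remainder R⁻¹)) =
      Real.log ((R + √√R⁻¹ * R) / (1 - 2 * (√√R⁻¹ / 4))) +
        12 / (√√R⁻¹ / 4) ^ 2 * Real.exp (-(√√R⁻¹ / 4 / 4 * (√√R⁻¹ * R))) := by
  have hR0 : 0 < R := by linarith
  have hs0 : 0 < √R⁻¹ := Real.sqrt_pos.2 (inv_pos.2 hR0)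
  have hq0 : 0 < √√R⁻¹ := Real.sqrt_pos.2 hs0
  have hq1 : √√R⁻¹ ≤ 1 := Real.sqrt_le_one.2 (Real.sqrt_le_one.2 (inv_le_one_of_one_le₀ hR))
  have hqs : √√R⁻¹ ^ 2 = √R⁻¹ := Real.sq_sqrt hs0.le
  have hsR : √R⁻¹ * R = (√R⁻¹)⁻¹ := by
    have : √R⁻¹ * √R⁻¹ = R⁻¹ := Real.mul_self_sqrt (inv_nonneg.2 hR0.le)
    refine eq_inv_of_mul_eq_one_left ?_
    rw [mul_right_comm, this, inv_mul_cancel₀ hR0.ne']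
  have hd : 0 < 1 - √√R⁻¹ / 2 := by linarith
  have e1 : √√R⁻¹ / 4 / 4 * (√√R⁻¹ * R) = (√R⁻¹)⁻¹ / 16 := by
    rw [← hsR]; linear_combination R / 16 * hqs
  have e2 : 12 / (√√R⁻¹ / 4) ^ 2 = 192 * (√R⁻¹)⁻¹ := by
    rw [div_pow, hqs]; field_simp; norm_num
  have e3 : R * (1 + remainder R⁻¹) = (R + √√R⁻¹ * R) / (1 - 2 * (√√R⁻¹ / 4)) *
      Real.exp (192 * ((√R⁻¹)⁻¹ * Real.exp (-((√R⁻¹)⁻¹ / 16)))) := by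
    rw [show 1 - 2 * (√√R⁻¹ / 4) = 1 - √√R⁻¹ / 2 by ring, remainder]
    ring
  have hpos : 0 < (R + √√R⁻¹ * R) / (1 - 2 * (√√R⁻¹ / 4)) :=
    div_pos (by positivity) (by linarith)
  rw [e1, e2, e3, Real.log_mul hpos.ne' (Real.exp_pos _).ne', Real.log_exp, mul_assoc]

/-! ### The oracle inequality -/

section probability

variable {Ω : Type*} [MeasurableSpace Ω] {P : Measure Ω}
  {ξ : ℕ → Ω → ℝ} {σ : ℝ} {μ : ℕ → ℝ} {M : Finset ℕ}

lemma risk_congr_ae {η : ℕ → Ω → ℝ} (h : ∀ i, ξ i =ᵐ[P] η i) (est : (ℕ → ℝ) → ℕ → ℝ) :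
    risk P ξ σ μ est = risk P η σ μ est := by
  refine lintegral_congr_ae ?_
  filter_upwards [ae_all_iff.2 h] with ω hω
  rw [funext hω]

lemma risk_le_of_measurable [IsProbabilityMeasure P] (mξ : ∀ i, Measurable (ξ i))
    (hlaw : ∀ i, HasLaw (ξ i) (gaussianReal 0 1) P) (hind : iIndepFun ξ P) (hσ : 0 < σ)
    (hμ : Summable fun i => μ i ^ 2) (hM : M.Nonempty) (hM1 : ∀ m ∈ M, 1 ≤ m) :
    risk P ξ σ μ (combEst M (expWeight σ M)) ≤ ENNReal.ofReal (oracleRisk σ M hM μ +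
      4 * σ ^ 2 * Real.log (oracleRisk σ M hM μ / σ ^ 2 *
        (1 + remainder (σ ^ 2 / oracleRisk σ M hM μ)))) := by
  obtain ⟨m₀, hm₀, hor⟩ := Finset.exists_mem_eq_inf' hM
    (fun m => (∑' i, μ (m + i) ^ 2) + σ ^ 2 * (m : ℝ))
  have hr : oracleRisk σ M hM μ = (∑' i, μ (m₀ + i) ^ 2) + σ ^ 2 * (m₀ : ℝ) := hor
  set r := oracleRisk σ M hM μ
  have hσ2 : 0 < σ ^ 2 := by positivity
  have hR : r / σ ^ 2 = (∑' i, μ (m₀ + i) ^ 2) / σ ^ 2 + m₀ := by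
    rw [hr]; field_simp
  have hbias : 0 ≤ (∑' i, μ (m₀ + i) ^ 2) / σ ^ 2 :=
    div_nonneg (tsum_nonneg fun _ => sq_nonneg _) (sq_nonneg _)
  have hm₀1 : (1 : ℝ) ≤ m₀ := by exact_mod_cast hM1 m₀ hm₀
  have hR1 : 1 ≤ r / σ ^ 2 := by rw [hR]; linarith
  rw [risk_eq mξ hlaw hind hσ hμ hM, ← inv_div r (σ ^ 2), log_mul_one_add_remainder hR1]
  refine ENNReal.ofReal_le_ofReal ?_
  set R := r / σ ^ 2
  have hq0 : 0 < √√R⁻¹ := Real.sqrt_pos.2 (Real.sqrt_pos.2 (inv_pos.2 (by linarith)))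
  have hq1 : √√R⁻¹ ≤ 1 := Real.sqrt_le_one.2 (Real.sqrt_le_one.2 (inv_le_one_of_one_le₀ hR1))
  have hmain := integral_sum_expWeight_mul_riskDiff_le mξ hlaw hind hσ hμ hM1 hm₀
    (θ := √√R⁻¹ / 4) (K := √√R⁻¹ * R) (by positivity) (by linarith) (by positivity) hR
  have hpoint : ∀ ω, ∑ m ∈ M, expWeight σ M (obs σ μ (fun j => ξ j ω)) m *
      riskEst σ m (obs σ μ (fun j => ξ j ω)) = riskEst σ m₀ (obs σ μ (fun j => ξ j ω)) +
      4 * σ ^ 2 * ∑ m ∈ M, expWeight σ M (obs σ μ (fun j => ξ j ω)) m *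
        ((riskEst σ m (obs σ μ (fun j => ξ j ω)) - riskEst σ m₀ (obs σ μ (fun j => ξ j ω))) /
          (4 * σ ^ 2)) := by
    intro ω
    have h1 : riskEst σ m₀ (obs σ μ (fun j => ξ j ω)) =
        ∑ m ∈ M, expWeight σ M (obs σ μ (fun j => ξ j ω)) m *
          riskEst σ m₀ (obs σ μ (fun j => ξ j ω)) := by
      rw [← Finset.sum_mul, sum_expWeight hM, one_mul]
    rw [h1, Finset.mul_sum, ← Finset.sum_add_distrib]
    refine Finset.sum_congr rfl fun m _ => ?_
    rw [← h1]
    field_simp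
    ring
  have hint : Integrable (fun ω => ∑ m ∈ M, expWeight σ M (obs σ μ (fun j => ξ j ω)) m *
        ((riskEst σ m (obs σ μ (fun j => ξ j ω)) - riskEst σ m₀ (obs σ μ (fun j => ξ j ω))) /
          (4 * σ ^ 2))) P := by
    have h := ((integrable_finsetSum M fun m hm => integrable_expWeight_mul_riskEst (σ := σ)
      (μ := μ) mξ hlaw hM hm m).sub (integrable_riskEst (σ := σ) (μ := μ) hlaw m₀)).div_const
      (4 * σ ^ 2)
    refine h.congr (Filter.Eventually.of_forall fun ω => ?_)
    simp only [Pi.sub_apply, hpoint ω]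
    field_simp
    ring
  have hhead : ∑' i, μ i ^ 2 = ∑ i ∈ Finset.range m₀, μ i ^ 2 + ∑' i, μ (m₀ + i) ^ 2 := by
    rw [← hμ.sum_add_tsum_nat_add m₀]
    simp only [add_comm]
  simp_rw [hpoint]
  rw [integral_add (integrable_riskEst hlaw m₀) (hint.const_mul _), integral_const_mul,
    integral_riskEst hlaw, hhead]
  have := mul_le_mul_of_nonneg_left hmain (by positivity : (0 : ℝ) ≤ 4 * σ ^ 2)
  linarith

end probability

end ExpWeighting

theorem theorem3 :
    ∃ Ψ : ℝ → ℝ,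
      (∃ C : ℝ, ∀ r ∈ Set.Icc (0 : ℝ) 1, 0 ≤ Ψ r ∧ Ψ r ≤ C) ∧
      Filter.Tendsto Ψ (nhdsWithin 0 (Set.Ioi 0)) (nhds 0) ∧
      ∀ (Ω : Type*) [MeasurableSpace Ω] (P : MeasureTheory.Measure Ω)
        [MeasureTheory.IsProbabilityMeasure P] (ξ : ℕ → Ω → ℝ)
        (_ : ∀ i, ProbabilityTheory.HasLaw (ξ i) (ProbabilityTheory.gaussianReal 0 1) P)
        (_ : ProbabilityTheory.iIndepFun ξ P)
        (σ : ℝ) (_ : 0 < σ)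
        (μ : ℕ → ℝ) (_ : Summable (fun i => μ i ^ 2))
        (M : Finset ℕ) (hM : M.Nonempty) (_ : ∀ m ∈ M, 1 ≤ m),
        ExpWeighting.risk P ξ σ μ (ExpWeighting.combEst M (ExpWeighting.expWeight σ M)) ≤
          ENNReal.ofReal
            (ExpWeighting.oracleRisk σ M hM μ +
              4 * σ ^ 2 *
                Real.log (ExpWeighting.oracleRisk σ M hM μ / σ ^ 2 *
                  (1 + Ψ (σ ^ 2 / ExpWeighting.oracleRisk σ M hM μ)))) := by
  refine ⟨ExpWeighting.remainder, ⟨_, fun r hr => ExpWeighting.remainder_mem hr.2⟩,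
    ExpWeighting.tendsto_remainder, ?_⟩
  intro Ω _ P _ ξ hlaw hind σ hσ μ hμ M hM hM1
  -- The noise is only almost everywhere measurable: pass to a measurable modification.
  have hae := fun i => (hlaw i).aemeasurable.ae_eq_mk
  rw [ExpWeighting.risk_congr_ae hae]
  exact ExpWeighting.risk_le_of_measurable (fun i => (hlaw i).aemeasurable.measurable_mk)
    (fun i => (hlaw i).congr (hae i).symm) (hind.congr hae) hσ hμ hM hM1
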